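/- Let $n\ge 1$ be an integer, and for integers $r\ge 0$ write $\binom{n}{r}_X=\prod_{i=0}^{r-1}\frac{1-X^{n-i}}{1-X^{r-i}}$ for the Gaussian binomial. (1) Let $\mathfrak o$ be a compact discrete valuation ring (compact in its $\mathfrak m$-adic topology) with maximal ideal $\mathfrak m=\pi\mathfrak o$ and residue field of cardinality $q$. Write $\Lambda\le_s\mathfrak o^n$ if $\Lambda$ is a finite-index $\mathfrak o$-submodule of $\mathfrak o^n$ closed under componentwise multiplication. Every $\Lambda\le_s\mathfrak o^n$ with $\Lambda\subseteq\pi\mathfrak o^n$ has index $q^m$ for some $m\ge n$, and $$\#\{\Lambda\le_s\mathfrak o^n:\ [\mathfrak o^n:\Lambda]=q^{n},\ \Lambda\subseteq\pi\mathfrak o^n\}=1,$$ $$\#\{\Lambda\le_s\mathfrak o^n:\ [\mathfrak o^n:\Lambda]=q^{n+1},\ \Lambda\subseteq\pi\mathfrak o^n\}=\binom{n}{1}_q,$$ $$\#\{\Lambda\le_s\mathfrak o^n:\ [\mathfrak o^n:\Lambda]=q^{n+2},\ \Lambda\subseteq\pi\mathfrak o^n\}=\binom{n+1}{2}q^{n-1}+\binom{n}{2}_q.$$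 (2) For a prime $p$, call a subring $\Lambda\le\mathbb Z_p^{k}$ irreducible if every $(x_1,\dots,x_k)\in\Lambda$ satisfies $x_1\equiv\cdots\equiv x_k\pmod p$, and let $g_k(p^e)$ be the number of irreducible subrings of $\mathbb Z_p^k$ of index $p^e$ that contain the identity $(1,\dots,1)$. Then for every prime $p$ $$g_{n+1}(p^n)=1,\qquad g_{n+1}(p^{n+1})=\frac{1-p^n}{1-p},\qquad g_{n+1}(p^{n+2})=\binom{n+1}{2}p^{n-1}+\binom{n}{2}_p.$$ -/

import Mathlib

/-- The Gaussian binomial `∏_{i=0}^{r-1} (1 - X^{n-i}) / (1 - X^{r-i})`, evaluated at a rational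
number `X` (not a root of unity). For `n < r` the factor with `i = n` vanishes. -/
def gaussianBinomial (n r : ℕ) (X : ℚ) : ℚ :=
  ∏ i ∈ Finset.range r, (1 - X ^ (n - i)) / (1 - X ^ (r - i))

/-- The index `[Oⁿ : Λ]` of an `O`-subalgebra of `Oⁿ` (an `O`-submodule closed under componentwise
multiplication, not necessarily containing `1`) as an additive subgroup; it is `0` when infinite. -/
noncomputable def subalgebraIndex {O : Type*} [CommRing O] {n : ℕ}
    (L : NonUnitalSubalgebra O (Fin n → O)) : ℕ :=
  L.toSubmodule.toAddSubgroup.index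

/-- The set `π Oⁿ`. -/
def uniformizerMultiples {O : Type*} [CommRing O] (π : O) (n : ℕ) : Set (Fin n → O) :=
  Set.range fun y : Fin n → O => π • y

/-- The number of `O`-subalgebras `Λ` of `Oⁿ` of index `N` with `Λ ⊆ π Oⁿ`. -/
noncomputable def subalgebraCount {O : Type*} [CommRing O] (π : O) (n N : ℕ) : ℕ :=
  Set.ncard {L : NonUnitalSubalgebra O (Fin n → O) |
    subalgebraIndex L = N ∧ (L : Set (Fin n → O)) ⊆ uniformizerMultiples π n}

/-- A subring `Λ` of `ℤ_pⁿ` (not necessarily unital) is irreducible if the coordinates of each of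
its elements are all congruent modulo `p`. -/
def IsIrreducibleSubring {p : ℕ} [Fact p.Prime] {n : ℕ}
    (L : NonUnitalSubring (Fin n → ℤ_[p])) : Prop :=
  ∀ x ∈ L, ∀ i j : Fin n, (p : ℤ_[p]) ∣ x i - x j

/-- `g_n(p^e)`: the number of irreducible subrings of `ℤ_pⁿ` of index `p^e` that contain the
identity `(1, …, 1)`. -/
noncomputable def irreducibleSubringCount (p : ℕ) [Fact p.Prime] (n e : ℕ) : ℕ :=
  Set.ncard {L : NonUnitalSubring (Fin n → ℤ_[p]) |
    IsIrreducibleSubring L ∧ 1 ∈ L ∧ L.toAddSubgroup.index = p ^ e}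

/-! Multiplication by `π` matches the subalgebras `Λ ⊆ π Oⁿ` with the submodules `M = π⁻¹Λ` such
that `π • (x * y) ∈ M` for `x, y ∈ M`, and `[Oⁿ : Λ] = qⁿ |Oⁿ / M|` (`subalgebraIndex_eq`,
`subalgebraCount_eq`). So one counts such `M` with `|Oⁿ / M| = q^k`, `k ≤ 2`. Either `π` kills the
quotient, which is then `F^k` over the residue field `F`, or `k = 2` and the quotient is `O / m²`
(`nonempty_equiv_pi_or_quotient_sq`).

The submodules with quotient `Q` are counted as surjections `Oⁿ → Q` divided by automorphisms of
`Q`. For `Q = F^k` the closure condition is automatic, since `π Oⁿ ⊆ M`, and the count is a Gaussian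
binomial. For `Q = O / m²` the condition on a surjection depends only on its reduction `Oⁿ → F`,
whose kernel must be multiplicatively closed (`surjective_and_ker_iff`). Such forms are exactly `c
xᵢ` and `c (xᵢ - xⱼ)` with `c ≠ 0`, so there are `(n+1 choose 2)(q - 1)` of them. Each has `qⁿ`
lifts, and `O / m²` has `q (q - 1)` automorphisms, which gives `(n+1 choose 2) q^(n-1)`.

For the second part, subtracting the coordinate `x 0` turns unital irreducible subrings of
`ℤ_p^(n+1)` into subalgebras of `ℤ_pⁿ` inside `p ℤ_pⁿ`, with the same index
(`irreducibleSubringCount_eq`). -/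

/-! ### Counting submodules by their quotient -/

/-- A surjection onto `Q` is its kernel `M` together with an isomorphism `V / M ≃ Q`, and for fixed
`M` these isomorphisms form a torsor under the automorphisms of `Q`. -/
theorem ncard_quotient_equiv_mul_card_aut {R V Q : Type*} [Ring R] [AddCommGroup V] [Module R V]
    [AddCommGroup Q] [Module R Q] (P : Submodule R V → Prop) :
    {M : Submodule R V | Nonempty ((V ⧸ M) ≃ₗ[R] Q) ∧ P M}.ncard * Nat.card (Q ≃ₗ[R] Q) =
      Nat.card {f : V →ₗ[R] Q // Function.Surjective f ∧ P (LinearMap.ker f)} := by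
  rw [← Nat.card_coe_set_eq, ← Nat.card_prod]
  have ker_eq (M : Submodule R V) (e : (V ⧸ M) ≃ₗ[R] Q) :
      LinearMap.ker (e.toLinearMap ∘ₗ M.mkQ) = M := by
    rw [LinearEquiv.ker_comp, Submodule.ker_mkQ]
  refine Nat.card_congr (Equiv.ofBijective (fun x =>
    ⟨(x.1.2.1.some.trans x.2).toLinearMap ∘ₗ x.1.1.mkQ,
      (x.1.2.1.some.trans x.2).surjective.comp x.1.1.mkQ_surjective,
      by rw [ker_eq]; exact x.1.2.2⟩) ⟨?_, ?_⟩)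
  · rintro ⟨⟨M, hM⟩, σ⟩ ⟨⟨N, hN⟩, τ⟩ h
    have h' := congrArg Subtype.val h
    have hMN : M = N := by
      rw [← ker_eq M (hM.1.some.trans σ), ← ker_eq N (hN.1.some.trans τ)]
      exact congrArg LinearMap.ker h'
    subst hMN
    congr 1
    ext x
    obtain ⟨v, hv⟩ := (hM.1.some.surjective.comp M.mkQ_surjective) x
    have := LinearMap.congr_fun h' v
    simp only [Function.comp_apply] at hv
    simpa [← hv] using this
  · rintro ⟨f, hf, hP⟩
    have hne : Nonempty ((V ⧸ LinearMap.ker f) ≃ₗ[R] Q) := ⟨f.quotKerEquivOfSurjective hf⟩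
    refine ⟨⟨⟨LinearMap.ker f, hne, hP⟩, hne.some.symm.trans (f.quotKerEquivOfSurjective hf)⟩, ?_⟩
    apply Subtype.ext
    ext v
    simp

theorem finite_setOf_quotient_equiv {R V Q : Type*} [Ring R] [AddCommGroup V] [Module R V]
    [AddCommGroup Q] [Module R Q] [Finite (V →ₗ[R] Q)] :
    {M : Submodule R V | Nonempty ((V ⧸ M) ≃ₗ[R] Q)}.Finite := by
  refine (Set.finite_range (fun f : V →ₗ[R] Q => LinearMap.ker f)).subset ?_
  rintro M ⟨e⟩
  exact ⟨e.toLinearMap ∘ₗ M.mkQ, by simp only [LinearEquiv.ker_comp, Submodule.ker_mkQ]⟩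

/-- All fibres are cosets of the kernel, so each has `|A| / |B|` elements; the form is
division-free. -/
theorem AddMonoidHom.card_preimage_mul_card {A B : Type*} [AddGroup A] [AddGroup B] [Finite A]
    (f : A →+ B) (hf : Function.Surjective f) (S : Set B) :
    Nat.card (f ⁻¹' S) * Nat.card B = Nat.card S * Nat.card A := by
  have : Finite B := Finite.of_surjective f hf
  have key (T : Set B) : Nat.card (f ⁻¹' T) = Nat.card T * Nat.card f.ker := by
    rw [← Nat.card_prod]
    choose s hs using hf
    refine Nat.card_congr ⟨fun x => (⟨f x.1, x.2⟩, ⟨x.1 - s (f x.1), by simp [hs]⟩),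
      fun y => ⟨y.2.1 + s y.1.1, ?_⟩, fun x => by simp, fun y => ?_⟩
    · have := y.2.2
      rw [AddMonoidHom.mem_ker] at this
      simp [this, hs]
    · have := y.2.2
      rw [AddMonoidHom.mem_ker] at this
      ext <;> simp [this, hs]
  have h := key Set.univ
  rw [Set.preimage_univ, Nat.card_univ, Nat.card_univ] at h
  rw [key, h]
  ring

/-! ### Linear algebra over a residue field -/

section SurjectiveScalars

variable {R F V : Type*} [CommRing R] [Field F] [Algebra R F] [AddCommGroup V] [Module R V]

theorem linearIndependent_proj_iff_surjective (hF : Function.Surjective (algebraMap R F)) {k : ℕ}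
    (w : Fin k → V →ₗ[R] F) :
    LinearIndependent F w ↔ Function.Surjective (LinearMap.pi w) := by
  constructor
  · intro h
    -- The image is an `F`-subspace because scalars lift to `R`. If it were proper, a nonzero
    -- functional vanishing on it would be a linear relation among the `w i`.
    let W : Submodule F (Fin k → F) :=
      { (LinearMap.pi w).range with
        smul_mem' := by
          rintro c _ ⟨v, rfl⟩
          obtain ⟨r, rfl⟩ := hF c
          exact ⟨r • v, by ext; simp [Algebra.smul_def]⟩ }
    have hW : W = ⊤ := by
      by_contra hne
      obtain ⟨g, hg, hgW⟩ := Submodule.exists_le_ker_of_lt_top W (lt_top_iff_ne_top.2 hne)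
      apply hg
      have hz : ∑ i, g (Pi.single i 1) • w i = 0 := by
        ext v
        have hv : g (LinearMap.pi w v) = 0 := hgW ⟨v, rfl⟩
        rw [pi_eq_sum_univ' (LinearMap.pi w v)] at hv
        simpa [← Pi.single_apply, mul_comm, Function.comp_def] using hv
      have := Fintype.linearIndependent_iff.1 h _ hz
      ext i
      simpa using this i
    intro y
    have : y ∈ W := hW ▸ Submodule.mem_top
    exact this
  · intro h
    rw [Fintype.linearIndependent_iff]
    intro g hg i
    obtain ⟨v, hv⟩ := h (Pi.single i 1)
    have h1 := LinearMap.congr_fun hg v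
    have h2 (j : Fin k) : w j v = (Pi.single i 1 : Fin k → F) j := congrFun hv j
    simpa [h2, Pi.single_apply] using h1

theorem card_surjective_pi [Finite F] (hF : Function.Surjective (algebraMap R F)) (n k : ℕ) :
    Nat.card {f : (Fin n → R) →ₗ[R] (Fin k → F) // Function.Surjective f} =
      ∏ i ∈ Finset.range k, (Nat.card F ^ n - Nat.card F ^ i) := by
  have : Fintype F := Fintype.ofFinite F
  let e := (Pi.basisFun R (Fin n)).constr F (M' := F)
  have hfin : Finite ((Fin n → R) →ₗ[R] F) := Finite.of_equiv _ e.toEquiv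
  have hrank : Module.finrank F ((Fin n → R) →ₗ[R] F) = n := by
    rw [← e.finrank_eq]; simp
  have hcongr : Nat.card {f : (Fin n → R) →ₗ[R] (Fin k → F) // Function.Surjective f} =
      Nat.card {w : Fin k → (Fin n → R) →ₗ[R] F // LinearIndependent F w} := by
    refine Nat.card_congr (Equiv.subtypeEquiv
      ⟨fun f i => LinearMap.proj i ∘ₗ f, fun w => LinearMap.pi w, fun _ => rfl, fun _ => rfl⟩ ?_)
    intro f
    rw [linearIndependent_proj_iff_surjective hF]
    rfl
  rw [hcongr]
  rcases le_or_gt k n with hkn | hkn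
  · rw [card_linearIndependent (by omega), hrank, Fintype.card_eq_nat_card, Fin.prod_univ_eq_prod_range (fun i => Nat.card F ^ n - Nat.card F ^ i)]
  -- For `n < k` the factor with `i = n` vanishes, and `F ^ n` has no `k` independent vectors.
  · rw [Finset.prod_eq_zero (Finset.mem_range.2 hkn) (by simp)]
    rw [Nat.card_eq_zero]
    left
    refine ⟨fun ⟨w, hw⟩ => ?_⟩
    have := hw.fintype_card_le_finrank
    simp at this
    omega

theorem card_aut_pi [Finite F] (hF : Function.Surjective (algebraMap R F)) (k : ℕ) :
    Nat.card ((Fin k → F) ≃ₗ[R] (Fin k → F)) =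
      ∏ i ∈ Finset.range k, (Nat.card F ^ k - Nat.card F ^ i) := by
  have : Fintype F := Fintype.ofFinite F
  rw [← Fin.prod_univ_eq_prod_range (fun i => Nat.card F ^ k - Nat.card F ^ i),
    ← Fintype.card_eq_nat_card (α := F), ← Matrix.card_GL_field]
  refine Nat.card_congr (Equiv.trans ?_ (Matrix.GeneralLinearGroup.toLin.trans
    (LinearMap.GeneralLinearGroup.generalLinearEquiv F (Fin k → F))).toEquiv.symm)
  exact ⟨fun e => e.extendScalarsOfSurjective hF, fun e => e.restrictScalars R,
    fun _ => rfl, fun _ => rfl⟩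

/-- The number of submodules of `R ^ n` with quotient `F ^ k`, where `F` is a residue field. -/
theorem ncard_quotient_equiv_pi [Finite F] (hF : Function.Surjective (algebraMap R F)) (n k : ℕ) :
    {M : Submodule R (Fin n → R) | Nonempty (((Fin n → R) ⧸ M) ≃ₗ[R] (Fin k → F))}.ncard *
      ∏ i ∈ Finset.range k, (Nat.card F ^ k - Nat.card F ^ i) =
      ∏ i ∈ Finset.range k, (Nat.card F ^ n - Nat.card F ^ i) := by
  have h := ncard_quotient_equiv_mul_card_aut (R := R) (V := Fin n → R) (Q := Fin k → F)
    (fun _ => True)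
  simp only [and_true] at h
  rw [card_aut_pi hF, card_surjective_pi hF] at h
  exact h

/-! ### Forms with multiplicatively closed kernel -/

/-- The linear forms on `R ^ n` whose kernel is closed under componentwise multiplication. -/
def subalgebraForms (R F : Type*) [CommRing R] [Field F] [Algebra R F] (n : ℕ) :
    Set ((Fin n → R) →ₗ[R] F) :=
  {f | f ≠ 0 ∧ ∀ x y, f x = 0 → f y = 0 → f (x * y) = 0}


/-- The coefficient vector of `c x_i` (if `i = j`) or of `c (x_i - x_j)`. -/
def pairVector {F : Type*} [Field F] {n : ℕ} (p : {p : Fin n × Fin n // p.1 ≤ p.2}) (c : Fˣ) :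
    Fin n → F :=
  fun k => if k = p.1.1 then c else if k = p.1.2 then -c else 0

/-- The ordering `i ≤ j` excludes the coincidence of `(i, j, c)` with `(j, i, -c)`: `i` is the least
index of the support and `c` the entry there. -/
theorem pairVector_injective {F : Type*} [Field F] {n : ℕ} :
    Function.Injective fun x : {p : Fin n × Fin n // p.1 ≤ p.2} × Fˣ => pairVector x.1 x.2 := by
  rintro ⟨⟨⟨i, j⟩, hij⟩, c⟩ ⟨⟨⟨i', j'⟩, hij'⟩, c'⟩ h
  have hk (k : Fin n) := congrFun h k
  simp only [pairVector] at hk hij hij'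
  have hc := c.ne_zero
  have hc' := c'.ne_zero
  have hi : i = i' := by
    have h1 := hk i
    have h2 := hk i'
    grind
  subst hi
  have hcc : c = c' := by
    have h1 := hk i
    simp only [if_true] at h1
    exact Units.ext h1
  subst hcc
  have hj : j = j' := by
    have h1 := hk j
    have h2 := hk j'
    have : -(c : F) ≠ 0 := neg_ne_zero.2 hc
    grind
  subst hj
  rfl

/-- Products of the kernel vectors `bⱼ eᵢ - bᵢ eⱼ` force at most two nonzero coefficients, and two
must be opposite. Conversely, `xᵢ = 0` and `xᵢ = xⱼ` are preserved by products. -/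
theorem mem_subalgebraForms_iff (hF : Function.Surjective (algebraMap R F)) {n : ℕ}
    (b : Fin n → F) :
    (Pi.basisFun R (Fin n)).constr F b ∈ subalgebraForms R F n ↔
      ∃ p c, pairVector p c = b := by
  have happ (x : Fin n → R) :
      (Pi.basisFun R (Fin n)).constr F b x = ∑ i, algebraMap R F (x i) * b i := by
    simp [Module.Basis.constr_apply_fintype, Algebra.smul_def]
  have hsingle (i : Fin n) (r : R) :
      (Pi.basisFun R (Fin n)).constr F b (Pi.single i r) = algebraMap R F r * b i := by
    rw [happ, Finset.sum_eq_single i] <;> simp +contextual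
  constructor
  · rintro ⟨hne, hmul⟩
    choose β hβ using fun i => hF (b i)
    have hpair (i j : Fin n) : (Pi.basisFun R (Fin n)).constr F b
        (Pi.single i (β j) - Pi.single j (β i)) = 0 := by
      rw [map_sub, hsingle, hsingle, hβ, hβ]; ring
    -- The square of `bⱼ eᵢ - bᵢ eⱼ` lies in the kernel, which gives `bᵢ bⱼ (bᵢ + bⱼ) = 0`.
    have htwo (i j : Fin n) (hij : i ≠ j) (hi : b i ≠ 0) (hj : b j ≠ 0) : b j = -b i := by
      have h := hmul _ _ (hpair i j) (hpair i j)
      have hx : (Pi.single i (β j) - Pi.single j (β i) : Fin n → R) *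
          (Pi.single i (β j) - Pi.single j (β i)) =
          Pi.single i (β j * β j) + Pi.single j (β i * β i) := by
        ext k
        simp only [Pi.mul_apply, Pi.sub_apply, Pi.add_apply, Pi.single_apply]
        grind
      rw [hx, map_add, hsingle, hsingle, map_mul, map_mul, hβ, hβ] at h
      have : b i * b j * (b j + b i) = 0 := by linear_combination h
      rcases mul_eq_zero.1 this with h | h
      · exact absurd h (mul_ne_zero hi hj)
      · linear_combination h
    -- The product of the kernel vectors for `(i, j)` and `(i, k)` is supported at `i` alone, which
    -- gives `bᵢ bⱼ bₖ = 0`.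
    have hthree (i j k : Fin n) (hij : i ≠ j) (hik : i ≠ k) (hjk : j ≠ k)
        (hi : b i ≠ 0) (hj : b j ≠ 0) : b k = 0 := by
      by_contra hk
      have h := hmul _ _ (hpair i j) (hpair i k)
      have hx : (Pi.single i (β j) - Pi.single j (β i) : Fin n → R) *
          (Pi.single i (β k) - Pi.single k (β i)) = Pi.single i (β j * β k) := by
        ext l
        simp only [Pi.mul_apply, Pi.sub_apply, Pi.single_apply]
        grind
      rw [hx, hsingle, map_mul, hβ, hβ] at h
      exact mul_ne_zero (mul_ne_zero hj hk) hi h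
    have hb : ∃ i, b i ≠ 0 := by
      by_contra! h0
      exact hne (LinearMap.ext fun x => by simp [happ, h0])
    obtain ⟨i, hi⟩ := hb
    by_cases h2 : ∃ j, j ≠ i ∧ b j ≠ 0
    · obtain ⟨j, hji, hj⟩ := h2
      rcases le_total i j with hij | hij
      · refine ⟨⟨(i, j), hij⟩, Units.mk0 _ hi, funext fun k => ?_⟩
        have h3 := htwo i j hji.symm hi hj
        have h4 := hthree i j k hji.symm
        simp only [pairVector, Units.val_mk0]
        grind
      · refine ⟨⟨(j, i), hij⟩, Units.mk0 _ hj, funext fun k => ?_⟩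
        have h3 := htwo j i hji hj hi
        have h4 := hthree i j k hji.symm
        simp only [pairVector, Units.val_mk0]
        grind
    · push Not at h2
      refine ⟨⟨(i, i), le_rfl⟩, Units.mk0 _ hi, funext fun k => ?_⟩
      have h3 := h2 k
      simp only [pairVector, Units.val_mk0]
      grind
  · rintro ⟨⟨⟨i, j⟩, hij⟩, c, rfl⟩
    have hc := c.ne_zero
    have hval (x : Fin n → R) : (Pi.basisFun R (Fin n)).constr F (pairVector ⟨(i, j), hij⟩ c) x =
        (algebraMap R F (x i) - if i = j then 0 else algebraMap R F (x j)) * c := by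
      rw [happ]
      have (k : Fin n) : algebraMap R F (x k) * pairVector ⟨(i, j), hij⟩ c k =
          (if k = i then algebraMap R F (x i) * c else 0) -
            (if k = j then (if i = j then 0 else algebraMap R F (x j)) * c else 0) := by
        simp only [pairVector]
        grind
      simp only [this, Finset.sum_sub_distrib, Finset.sum_ite_eq', Finset.mem_univ, if_true]
      ring
    refine ⟨fun h0 => ?_, fun x y hx hy => ?_⟩
    · have h1 := hsingle i 1
      rw [h0] at h1
      exact hc (by simpa [pairVector] using h1.symm)
    · rw [hval, mul_eq_zero, or_iff_left hc] at hx hy ⊢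
      rw [Pi.mul_apply, Pi.mul_apply, map_mul, map_mul]
      split_ifs at hx hy ⊢ with h
      · rw [sub_zero] at hx hy ⊢
        rw [hx, zero_mul]
      · rw [sub_eq_zero] at hx hy ⊢
        rw [hx, hy]

theorem card_subalgebraForms [Finite F] (hF : Function.Surjective (algebraMap R F)) (n : ℕ) :
    Nat.card (subalgebraForms R F n) = (n + 1).choose 2 * (Nat.card F - 1) := by
  have h1 : Nat.card {p : Fin n × Fin n // p.1 ≤ p.2} = (n + 1).choose 2 := by
    rw [← Nat.card_congr Sym2.sortEquiv, Nat.card_eq_fintype_card, Sym2.card, Fintype.card_fin]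
  rw [← h1, ← Nat.card_units, ← Nat.card_prod]
  refine (Nat.card_congr (Equiv.ofBijective (fun x =>
    ⟨(Pi.basisFun R (Fin n)).constr F (pairVector x.1 x.2),
      (mem_subalgebraForms_iff hF _).2 ⟨_, _, rfl⟩⟩) ⟨fun x y h => ?_, ?_⟩)).symm
  · exact pairVector_injective (((Pi.basisFun R (Fin n)).constr F).injective
      (congrArg Subtype.val h))
  · rintro ⟨f, hf⟩
    obtain ⟨b, rfl⟩ := ((Pi.basisFun R (Fin n)).constr F).surjective f
    obtain ⟨p, c, h⟩ := (mem_subalgebraForms_iff hF _).1 hf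
    exact ⟨(p, c), Subtype.ext (congrArg ((Pi.basisFun R (Fin n)).constr F) h)⟩

end SurjectiveScalars

/-! ### Finite modules over a local ring -/

open IsLocalRing

section LocalRing

variable {O : Type*} [CommRing O] [IsLocalRing O] {Q : Type*} [AddCommGroup Q] [Module O Q]
  [Finite Q]

theorem exists_linearEquiv_residueField_pi (h : ∀ a ∈ maximalIdeal O, ∀ x : Q, a • x = 0) :
    ∃ k : ℕ, Nonempty (Q ≃ₗ[O] (Fin k → ResidueField O)) := by
  have ht : Module.IsTorsionBySet O Q (maximalIdeal O) := fun x a => h a.1 a.2 x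
  let _ : Module (ResidueField O) Q := ht.module
  have : IsScalarTower O (ResidueField O) Q := ht.isScalarTower
  exact ⟨_, ⟨(Module.finBasis (ResidueField O) Q).equivFun.restrictScalars O⟩⟩

theorem card_residueField_pi (k : ℕ) :
    Nat.card (Fin k → ResidueField O) = Nat.card (ResidueField O) ^ k := by
  simp [Nat.card_fun]

variable (O Q) in
theorem exists_card_eq_residueField_card_pow :
    ∃ k : ℕ, Nat.card Q = Nat.card (ResidueField O) ^ k := by
  induction hc : Nat.card Q using Nat.strong_induction_on generalizing Q with
  | _ c ih =>
    subst hc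
    rcases subsingleton_or_nontrivial Q with hQ | hQ
    · exact ⟨0, by simp⟩
    · let N : Submodule O Q := maximalIdeal O • ⊤
      -- Nakayama's lemma makes `m Q` proper, so induction applies to it; the quotient `Q / m Q` is
      -- a vector space over `F`.
      have hN : N ≠ ⊤ := fun h => by
        have := Submodule.eq_bot_of_le_smul_of_le_jacobson_bot (maximalIdeal O) (⊤ : Submodule O Q)
          (Module.Finite.fg_top) h.ge (maximalIdeal_le_jacobson _)
        exact top_ne_bot this
      have hlt : Nat.card N < Nat.card Q :=
        Finite.card_subtype_lt (x := _) (Classical.not_forall.1 fun h => hN (eq_top_iff.2 fun x _ => h x)).choose_spec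
      obtain ⟨i, hi⟩ := ih _ hlt N rfl
      have : Finite (Q ⧸ N) := Finite.of_surjective _ N.mkQ_surjective
      obtain ⟨j, ⟨e⟩⟩ := exists_linearEquiv_residueField_pi (O := O) (Q := Q ⧸ N) (by
        intro a ha x
        obtain ⟨y, rfl⟩ := N.mkQ_surjective x
        rw [← map_smul]
        exact (Submodule.Quotient.mk_eq_zero _).2 (Submodule.smul_mem_smul ha trivial))
      refine ⟨i + j, ?_⟩
      rw [Submodule.card_eq_card_quotient_mul_card N, Nat.card_congr e.toEquiv,
        card_residueField_pi, hi, pow_add, mul_comm]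

end LocalRing

theorem card_linearMap_pi (O : Type*) [CommRing O] (Q : Type*) [AddCommGroup Q] [Module O Q] (n : ℕ) :
    Nat.card ((Fin n → O) →ₗ[O] Q) = Nat.card Q ^ n := by
  rw [← Nat.card_congr ((Pi.basisFun O (Fin n)).constr ℕ (M' := Q)).toEquiv, Nat.card_fun,
    Nat.card_fin]

instance finite_linearMap_pi (O : Type*) [CommRing O] (Q : Type*) [AddCommGroup Q] [Module O Q] [Finite Q] (n : ℕ) :
    Finite ((Fin n → O) →ₗ[O] Q) :=
  Finite.of_equiv _ ((Pi.basisFun O (Fin n)).constr ℕ (M' := Q)).toEquiv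

/-! ### The quotient `O / m²` -/

section DVR

variable {O : Type*} [CommRing O] [IsDomain O] [IsDiscreteValuationRing O]

theorem card_quotient_maximalIdeal_sq :
    Nat.card (O ⧸ maximalIdeal O ^ 2) = Nat.card (ResidueField O) ^ 2 :=
  cardQuot_pow_of_prime (IsDiscreteValuationRing.not_a_field O)

theorem le_maximalIdeal_sq_of_notMem {π : O} (hπ : maximalIdeal O = Ideal.span {π}) {I : Ideal O}
    (hI : π ∉ I) : I ≤ maximalIdeal O ^ 2 := by
  have hirr : Irreducible π := (IsDiscreteValuationRing.irreducible_iff_uniformizer π).2 hπ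
  rcases eq_or_ne I ⊥ with rfl | hne
  · exact bot_le
  · obtain ⟨k, rfl⟩ := IsDiscreteValuationRing.ideal_eq_span_pow_irreducible hne hirr
    rw [hπ, Ideal.span_singleton_pow, Ideal.span_singleton_le_span_singleton]
    refine pow_dvd_pow _ ?_
    by_contra! hk
    exact hI (Ideal.mem_span_singleton.2 (by simpa using pow_dvd_pow π (show k ≤ 1 by omega)))

/-- The annihilator of `x` does not contain `π`, so it lies in `m²`, and the cyclic module `O x ⊆ Q`
surjects onto `O / m²`. Equal cardinalities make both maps bijective. -/
theorem card_sq_le_and_equiv_of_smul_ne_zero {π : O} (hπ : maximalIdeal O = Ideal.span {π})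
    {Q : Type*} [AddCommGroup Q] [Module O Q] [Finite Q] {x : Q} (hx : π • x ≠ 0) :
    Nat.card (ResidueField O) ^ 2 ≤ Nat.card Q ∧
      (Nat.card Q = Nat.card (ResidueField O) ^ 2 →
        Nonempty (Q ≃ₗ[O] (O ⧸ maximalIdeal O ^ 2))) := by
  let f := LinearMap.toSpanSingleton O Q x
  have hle : LinearMap.ker f ≤ maximalIdeal O ^ 2 := le_maximalIdeal_sq_of_notMem hπ (by simpa [f])
  let g : (O ⧸ LinearMap.ker f) →ₗ[O] (O ⧸ maximalIdeal O ^ 2) := Submodule.factor hle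
  have hg : Function.Surjective g := Submodule.factor_surjective hle
  let e := f.quotKerEquivRange
  have hfin : Finite (O ⧸ LinearMap.ker f) := Finite.of_equiv _ e.symm.toEquiv
  have h1 := Nat.card_le_card_of_surjective g hg
  have h2 : Nat.card (O ⧸ LinearMap.ker f) ≤ Nat.card Q := by
    rw [Nat.card_congr e.toEquiv]
    exact Finite.card_subtype_le _
  rw [card_quotient_maximalIdeal_sq] at h1
  refine ⟨h1.trans h2, fun hc => ?_⟩
  have hfin' : Finite (O ⧸ maximalIdeal O ^ 2) := Finite.of_surjective g hg
  have hgb : Function.Bijective g := (Nat.bijective_iff_surjective_and_card g).2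
    ⟨hg, by rw [card_quotient_maximalIdeal_sq]; omega⟩
  let h : (O ⧸ LinearMap.ker f) →ₗ[O] Q := (LinearMap.range f).subtype ∘ₗ e.toLinearMap
  have hhb : Function.Bijective h := (Nat.bijective_iff_injective_and_card h).2
    ⟨(Submodule.injective_subtype _).comp e.injective, by omega⟩
  exact ⟨(LinearEquiv.ofBijective h hhb).symm.trans (LinearEquiv.ofBijective g hgb)⟩

/-- The reduction `O / m² → O / m`. -/
noncomputable def quotientSqToResidueField (O : Type*) [CommRing O] [IsLocalRing O] :
    (O ⧸ maximalIdeal O ^ 2) →ₗ[O] ResidueField O :=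
  Submodule.factor (Ideal.pow_le_self two_ne_zero)

theorem quotientSqToResidueField_surjective :
    Function.Surjective (quotientSqToResidueField O) :=
  Submodule.factor_surjective (Ideal.pow_le_self two_ne_zero)

theorem quotientSqToResidueField_mk (a : O) :
    quotientSqToResidueField O (Ideal.Quotient.mk _ a) = residue O a := rfl

theorem isUnit_iff_quotientSqToResidueField_ne_zero (a : O ⧸ maximalIdeal O ^ 2) :
    IsUnit a ↔ quotientSqToResidueField O a ≠ 0 := by
  obtain ⟨a, rfl⟩ := Ideal.Quotient.mk_surjective a
  rw [quotientSqToResidueField_mk, residue_ne_zero_iff_isUnit]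
  refine ⟨fun h => ?_, fun h => h.map _⟩
  by_contra hn
  have hn' : a ∈ maximalIdeal O := hn
  have hz := h.pow 2
  rw [← map_pow, Ideal.Quotient.eq_zero_iff_mem.2 (Ideal.pow_mem_pow hn' 2)] at hz
  have : Nontrivial (O ⧸ maximalIdeal O ^ 2) := Ideal.Quotient.nontrivial_iff.2 fun h1 =>
    (maximalIdeal.isMaximal O).ne_top (top_le_iff.1 (h1 ▸ Ideal.pow_le_self two_ne_zero))
  exact not_isUnit_zero hz

theorem smul_eq_zero_iff_quotientSqToResidueField_eq_zero {π : O}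
    (hπ : maximalIdeal O = Ideal.span {π}) (a : O ⧸ maximalIdeal O ^ 2) :
    π • a = 0 ↔ quotientSqToResidueField O a = 0 := by
  obtain ⟨a, rfl⟩ := Ideal.Quotient.mk_surjective a
  have hirr : Irreducible π := (IsDiscreteValuationRing.irreducible_iff_uniformizer π).2 hπ
  rw [quotientSqToResidueField_mk, residue_eq_zero_iff, Algebra.smul_def,
    Ideal.Quotient.algebraMap_eq, ← map_mul, Ideal.Quotient.eq_zero_iff_mem, hπ,
    Ideal.span_singleton_pow, Ideal.mem_span_singleton, Ideal.mem_span_singleton, pow_two,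
    mul_dvd_mul_iff_left hirr.ne_zero]

theorem exists_smul_eq_of_quotientSqToResidueField_eq_zero {π : O}
    (hπ : maximalIdeal O = Ideal.span {π}) {a : O ⧸ maximalIdeal O ^ 2}
    (ha : quotientSqToResidueField O a = 0) : ∃ b, π • b = a := by
  obtain ⟨a, rfl⟩ := Ideal.Quotient.mk_surjective a
  rw [quotientSqToResidueField_mk, residue_eq_zero_iff, hπ, Ideal.mem_span_singleton] at ha
  obtain ⟨b, rfl⟩ := ha
  exact ⟨Ideal.Quotient.mk _ b, by rw [Algebra.smul_def, Ideal.Quotient.algebraMap_eq, map_mul]⟩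

/-- Since `π` times a class of `O / m²` vanishes exactly when the class reduces to zero, `π z ∈ ker
f` means that the reduction of `f` kills `z`. For surjective `f` the kernel of the reduction is `ker
f + π Oⁿ`, and changing factors by `π Oⁿ` changes a product only by `π Oⁿ`, which the reduction
kills. -/
theorem surjective_and_ker_iff {π : O} (hπ : maximalIdeal O = Ideal.span {π}) {n : ℕ}
    (f : (Fin n → O) →ₗ[O] (O ⧸ maximalIdeal O ^ 2)) :
    (Function.Surjective f ∧ ∀ x ∈ LinearMap.ker f, ∀ y ∈ LinearMap.ker f,
      π • (x * y) ∈ LinearMap.ker f) ↔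
    quotientSqToResidueField O ∘ₗ f ∈ subalgebraForms O (ResidueField O) n := by
  have hsurj : Function.Surjective f ↔ quotientSqToResidueField O ∘ₗ f ≠ 0 := by
    constructor
    · intro h h0
      obtain ⟨a, ha⟩ := quotientSqToResidueField_surjective (O := O) 1
      obtain ⟨v, rfl⟩ := h a
      exact one_ne_zero (ha.symm.trans (LinearMap.congr_fun h0 v))
    · intro h a
      obtain ⟨v, hv⟩ := DFunLike.ne_iff.1 h
      obtain ⟨u, hu⟩ := (isUnit_iff_quotientSqToResidueField_ne_zero (f v)).2 hv
      obtain ⟨r, hr⟩ := Ideal.Quotient.mk_surjective (a * ((u⁻¹ : (O ⧸ maximalIdeal O ^ 2)ˣ) : O ⧸ maximalIdeal O ^ 2))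
      refine ⟨r • v, ?_⟩
      rw [map_smul, Algebra.smul_def, Ideal.Quotient.algebraMap_eq, hr, ← hu, mul_assoc,
        Units.inv_mul, mul_one]
  rw [hsurj]
  refine and_congr_right fun hne => ?_
  have key (z : Fin n → O) : π • z ∈ LinearMap.ker f ↔
      (quotientSqToResidueField O ∘ₗ f) z = 0 := by
    rw [LinearMap.mem_ker, map_smul, smul_eq_zero_iff_quotientSqToResidueField_eq_zero hπ]
    rfl
  have hlift (x : Fin n → O) (hx : (quotientSqToResidueField O ∘ₗ f) x = 0) :
      ∃ z, x - π • z ∈ LinearMap.ker f := by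
    obtain ⟨b, hb⟩ := exists_smul_eq_of_quotientSqToResidueField_eq_zero hπ hx
    obtain ⟨z, rfl⟩ := hsurj.2 hne b
    exact ⟨z, by rw [LinearMap.mem_ker, map_sub, map_smul, hb, sub_self]⟩
  have hπF (v : Fin n → O) : (quotientSqToResidueField O ∘ₗ f) (π • v) = 0 := by
    rw [map_smul, Algebra.smul_def, ResidueField.algebraMap_eq,
      (residue_eq_zero_iff π).2 (hπ ▸ Ideal.mem_span_singleton_self π), zero_mul]
  simp only [key]
  constructor
  · intro h x y hx hy
    obtain ⟨z, hz⟩ := hlift x hx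
    obtain ⟨w, hw⟩ := hlift y hy
    have h1 := h _ hz _ hw
    have h2 : x * y = (x - π • z) * (y - π • w) + π • (z * y + x * w - π • (z * w)) := by
      ext i
      simp only [Pi.mul_apply, Pi.add_apply, Pi.sub_apply, Pi.smul_apply, smul_eq_mul]
      ring
    rw [h2, map_add, h1, hπF, add_zero]
  · intro h x hx y hy
    refine h x y ?_ ?_
    · rw [LinearMap.comp_apply, LinearMap.mem_ker.1 hx, map_zero]
    · rw [LinearMap.comp_apply, LinearMap.mem_ker.1 hy, map_zero]

variable [Finite (ResidueField O)]

instance finite_quotient_maximalIdeal_sq : Finite (O ⧸ maximalIdeal O ^ 2) :=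
  (Nat.card_ne_zero.1 (by
    rw [card_quotient_maximalIdeal_sq]; exact pow_ne_zero _ Nat.card_pos.ne')).2

/-- Automorphisms correspond to units through `σ ↦ σ 1`, and the units are the classes with nonzero
reduction. -/
theorem card_aut_quotient_maximalIdeal_sq :
    Nat.card ((O ⧸ maximalIdeal O ^ 2) ≃ₗ[O] (O ⧸ maximalIdeal O ^ 2)) =
      Nat.card (ResidueField O) * (Nat.card (ResidueField O) - 1) := by
  have hs : Function.Surjective (algebraMap O (O ⧸ maximalIdeal O ^ 2)) :=
    Ideal.Quotient.mk_surjective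
  have h1 : Nat.card ((O ⧸ maximalIdeal O ^ 2) ≃ₗ[O] (O ⧸ maximalIdeal O ^ 2)) =
      Nat.card (quotientSqToResidueField O ⁻¹' {0}ᶜ) := by
    refine Nat.card_congr (Equiv.ofBijective (fun σ => ⟨σ 1,
      (isUnit_iff_quotientSqToResidueField_ne_zero _).1 ?_⟩) ⟨fun σ τ h => ?_, ?_⟩)
    · have h := map_smul (σ.extendScalarsOfSurjective hs) (σ.symm 1) 1
      simp only [smul_eq_mul, mul_one, LinearEquiv.extendScalarsOfSurjective_apply,
        LinearEquiv.apply_symm_apply] at h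
      exact IsUnit.of_mul_eq_one_right _ h.symm
    · have h' : σ 1 = τ 1 := congrArg Subtype.val h
      ext a
      have h1 := map_smul (σ.extendScalarsOfSurjective hs) a 1
      have h2 := map_smul (τ.extendScalarsOfSurjective hs) a 1
      simp only [smul_eq_mul, mul_one, LinearEquiv.extendScalarsOfSurjective_apply] at h1 h2
      rw [h1, h2, h']
    · rintro ⟨a, ha⟩
      obtain ⟨u, rfl⟩ := (isUnit_iff_quotientSqToResidueField_ne_zero a).2 ha
      exact ⟨(LinearEquiv.smulOfUnit u).restrictScalars O, Subtype.ext (mul_one _)⟩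
  have h2 := (quotientSqToResidueField O).toAddMonoidHom.card_preimage_mul_card
    quotientSqToResidueField_surjective {0}ᶜ
  rw [card_quotient_maximalIdeal_sq] at h2
  have h3 : Nat.card ({0}ᶜ : Set (ResidueField O)) = Nat.card (ResidueField O) - 1 := by
    rw [Nat.card_coe_set_eq, Set.ncard_compl, Set.ncard_singleton]
  rw [h1]
  refine Nat.eq_of_mul_eq_mul_right (Nat.card_pos (α := ResidueField O)) ?_
  rw [h3] at h2
  refine Eq.trans h2 ?_
  ring

theorem ncard_quotient_equiv_quotient_sq {π : O} (hπ : maximalIdeal O = Ideal.span {π}) {n : ℕ}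
    (hn : 1 ≤ n) :
    {M : Submodule O (Fin n → O) |
      Nonempty (((Fin n → O) ⧸ M) ≃ₗ[O] (O ⧸ maximalIdeal O ^ 2)) ∧
        ∀ x ∈ M, ∀ y ∈ M, π • (x * y) ∈ M}.ncard =
      (n + 1).choose 2 * Nat.card (ResidueField O) ^ (n - 1) := by
  have h := ncard_quotient_equiv_mul_card_aut (R := O) (V := Fin n → O)
    (Q := O ⧸ maximalIdeal O ^ 2) (fun M => ∀ x ∈ M, ∀ y ∈ M, π • (x * y) ∈ M)
  let Φ : ((Fin n → O) →ₗ[O] (O ⧸ maximalIdeal O ^ 2)) →+ ((Fin n → O) →ₗ[O] ResidueField O) :=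
    { toFun := fun f => quotientSqToResidueField O ∘ₗ f
      map_zero' := LinearMap.comp_zero _
      map_add' := fun f g => LinearMap.comp_add _ _ _ }
  -- Forms lift along `O / m² → F` because `Oⁿ` is projective.
  have hΦ : Function.Surjective Φ := fun f =>
    Module.projective_lifting_property _ f quotientSqToResidueField_surjective
  have h2 := Φ.card_preimage_mul_card hΦ (subalgebraForms O (ResidueField O) n)
  have h3 : Nat.card (Φ ⁻¹' subalgebraForms O (ResidueField O) n) =
      Nat.card {f : (Fin n → O) →ₗ[O] (O ⧸ maximalIdeal O ^ 2) // Function.Surjective f ∧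
        ∀ x ∈ LinearMap.ker f, ∀ y ∈ LinearMap.ker f, π • (x * y) ∈ LinearMap.ker f} :=
    Nat.card_congr (Equiv.subtypeEquivRight fun f => (surjective_and_ker_iff hπ f).symm)
  rw [h3, ← h, card_aut_quotient_maximalIdeal_sq, card_linearMap_pi, card_linearMap_pi,
    card_subalgebraForms residue_surjective, card_quotient_maximalIdeal_sq] at h2
  have hq : 1 < Nat.card (ResidueField O) := Finite.one_lt_card
  obtain ⟨k, rfl⟩ := Nat.exists_eq_add_of_le' hn
  rw [Nat.add_sub_cancel]
  refine Nat.eq_of_mul_eq_mul_right (Nat.mul_pos (Nat.mul_pos hq.le (Nat.sub_pos_of_lt hq))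
    (pow_pos hq.le (k + 1))) ?_
  rw [← mul_assoc, h2]
  ring

end DVR

/-! ### Division by the uniformizer and the counts -/

section DVR

variable {O : Type*} [CommRing O]

/-- The submodule `π⁻¹ L`. -/
def divSubmodule {n : ℕ} (π : O) (L : NonUnitalSubalgebra O (Fin n → O)) :
    Submodule O (Fin n → O) :=
  L.toSubmodule.comap (LinearMap.lsmul O (Fin n → O) π)

theorem mem_divSubmodule {n : ℕ} {π : O} {L : NonUnitalSubalgebra O (Fin n → O)}
    {x : Fin n → O} : x ∈ divSubmodule π L ↔ π • x ∈ L := Iff.rfl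

theorem map_divSubmodule {n : ℕ} {π : O} {L : NonUnitalSubalgebra O (Fin n → O)}
    (hL : (L : Set (Fin n → O)) ⊆ uniformizerMultiples π n) :
    (divSubmodule π L).map (LinearMap.lsmul O (Fin n → O) π) = L.toSubmodule :=
  Submodule.map_comap_eq_of_le hL

variable [IsDomain O] [IsDiscreteValuationRing O]

theorem smul_mem_of_quotient_equiv_pi {π : O} (hπ : maximalIdeal O = Ideal.span {π}) {n k : ℕ}
    {M : Submodule O (Fin n → O)} (e : ((Fin n → O) ⧸ M) ≃ₗ[O] (Fin k → ResidueField O))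
    (x : Fin n → O) : π • x ∈ M := by
  rw [← Submodule.Quotient.mk_eq_zero, ← e.map_eq_zero_iff, Submodule.Quotient.mk_smul, map_smul]
  ext i
  rw [Pi.smul_apply, Algebra.smul_def, ResidueField.algebraMap_eq,
    (residue_eq_zero_iff π).2 (hπ ▸ Ideal.mem_span_singleton_self π), zero_mul, Pi.zero_apply]

theorem index_range_lsmul {π : O} (hπ : maximalIdeal O = Ideal.span {π}) (n : ℕ) :
    (LinearMap.range (LinearMap.lsmul O (Fin n → O) π)).toAddSubgroup.index =
      Nat.card (ResidueField O) ^ n := by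
  let ρ : (Fin n → O) →+ (Fin n → ResidueField O) := (residue O).toAddMonoidHom.compLeft (Fin n)
  have hρ : Function.Surjective ρ := fun y => by
    choose x hx using fun i => residue_surjective (y i)
    exact ⟨x, funext hx⟩
  have hker : ρ.ker = (LinearMap.range (LinearMap.lsmul O (Fin n → O) π)).toAddSubgroup := by
    ext x
    have h1 : x ∈ ρ.ker ↔ ∀ i, residue O (x i) = 0 := funext_iff
    have h2 : x ∈ (LinearMap.range (LinearMap.lsmul O (Fin n → O) π)).toAddSubgroup ↔
        ∃ y, π • y = x := Iff.rfl
    rw [h1, h2]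
    simp only [residue_eq_zero_iff, hπ, Ideal.mem_span_singleton]
    constructor
    · intro h
      choose y hy using h
      exact ⟨y, funext fun i => (hy i).symm⟩
    · rintro ⟨y, rfl⟩ i
      exact dvd_mul_right _ _
  rw [← hker, AddSubgroup.index_ker, AddMonoidHom.range_eq_top.2 hρ,
    ← card_residueField_pi]
  exact Nat.card_congr AddSubgroup.topEquiv.toEquiv

theorem lsmul_injective {π : O} (hπ : maximalIdeal O = Ideal.span {π}) (n : ℕ) :
    Function.Injective (LinearMap.lsmul O (Fin n → O) π) := by
  have hirr : Irreducible π := (IsDiscreteValuationRing.irreducible_iff_uniformizer π).2 hπ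
  intro x y h
  ext i
  exact mul_left_cancel₀ hirr.ne_zero (congrFun h i)

theorem index_map_lsmul {π : O} (hπ : maximalIdeal O = Ideal.span {π}) {n : ℕ}
    (M : Submodule O (Fin n → O)) :
    (M.map (LinearMap.lsmul O (Fin n → O) π)).toAddSubgroup.index =
      Nat.card ((Fin n → O) ⧸ M) * Nat.card (ResidueField O) ^ n := by
  rw [← index_range_lsmul hπ n]
  exact AddSubgroup.index_map_of_injective M.toAddSubgroup
    (f := (LinearMap.lsmul O (Fin n → O) π).toAddMonoidHom) (lsmul_injective hπ n)

theorem subalgebraIndex_eq {π : O} (hπ : maximalIdeal O = Ideal.span {π}) {n : ℕ}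
    {L : NonUnitalSubalgebra O (Fin n → O)}
    (hL : (L : Set (Fin n → O)) ⊆ uniformizerMultiples π n) :
    subalgebraIndex L =
      Nat.card ((Fin n → O) ⧸ divSubmodule π L) * Nat.card (ResidueField O) ^ n := by
  rw [subalgebraIndex, ← index_map_lsmul hπ, map_divSubmodule hL]

theorem exists_subalgebraIndex_eq_pow {π : O} (hπ : maximalIdeal O = Ideal.span {π}) {n : ℕ}
    {L : NonUnitalSubalgebra O (Fin n → O)} (h0 : subalgebraIndex L ≠ 0)
    (hL : (L : Set (Fin n → O)) ⊆ uniformizerMultiples π n) :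
    ∃ m : ℕ, n ≤ m ∧ subalgebraIndex L = Nat.card (ResidueField O) ^ m := by
  rw [subalgebraIndex_eq hπ hL] at h0 ⊢
  have : Finite ((Fin n → O) ⧸ divSubmodule π L) :=
    (Nat.card_ne_zero.1 (left_ne_zero_of_mul h0)).2
  obtain ⟨k, hk⟩ := exists_card_eq_residueField_card_pow O ((Fin n → O) ⧸ divSubmodule π L)
  exact ⟨k + n, by omega, by rw [hk, pow_add]⟩

variable [Finite (ResidueField O)]

/-- From `(π x)(π y) = π (π x y)`, closure of `π M` under products becomes `π • (x * y) ∈ M`, and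
`π` is injective on `Oⁿ`. -/
theorem subalgebraCount_eq {π : O} (hπ : maximalIdeal O = Ideal.span {π}) (n k : ℕ) :
    subalgebraCount π n (Nat.card (ResidueField O) ^ (n + k)) =
      {M : Submodule O (Fin n → O) |
        Nat.card ((Fin n → O) ⧸ M) = Nat.card (ResidueField O) ^ k ∧
          ∀ x ∈ M, ∀ y ∈ M, π • (x * y) ∈ M}.ncard := by
  have hq : 0 < Nat.card (ResidueField O) ^ n := pow_pos Nat.card_pos n
  refine Set.ncard_congr (fun L _ => divSubmodule π L) ?_ ?_ ?_
  · rintro L ⟨hi, hL⟩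
    rw [subalgebraIndex_eq hπ hL, pow_add, mul_comm] at hi
    refine ⟨Nat.eq_of_mul_eq_mul_left hq hi, fun x hx y hy => ?_⟩
    rw [mem_divSubmodule] at hx hy ⊢
    have := mul_mem hx hy
    rwa [smul_mul_smul_comm, mul_smul] at this
  · rintro L L' ⟨-, hL⟩ ⟨-, hL'⟩ h
    have h' : L.toSubmodule = L'.toSubmodule := by
      rw [← map_divSubmodule hL, ← map_divSubmodule hL', h]
    exact NonUnitalSubalgebra.toSubmodule_injective h'
  · rintro M ⟨hM, hmul⟩
    let L : NonUnitalSubalgebra O (Fin n → O) :=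
      { M.map (LinearMap.lsmul O (Fin n → O) π) with
        mul_mem' := by
          rintro _ _ ⟨x, hx, rfl⟩ ⟨y, hy, rfl⟩
          refine ⟨π • (x * y), hmul x hx y hy, ?_⟩
          simp only [LinearMap.lsmul_apply]
          rw [smul_mul_smul_comm, mul_smul] }
    have hL : (L : Set (Fin n → O)) ⊆ uniformizerMultiples π n := by
      rintro _ ⟨x, -, rfl⟩
      exact ⟨x, rfl⟩
    have hdiv : divSubmodule π L = M :=
      Submodule.comap_map_eq_of_injective (lsmul_injective hπ n) M
    refine ⟨L, ⟨?_, hL⟩, hdiv⟩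
    rw [subalgebraIndex_eq hπ hL, hdiv, hM, pow_add, mul_comm]

theorem nonempty_equiv_pi_or_quotient_sq {π : O} (hπ : maximalIdeal O = Ideal.span {π})
    {Q : Type*} [AddCommGroup Q] [Module O Q] {k : ℕ} (hk : k ≤ 2)
    (hQ : Nat.card Q = Nat.card (ResidueField O) ^ k) :
    Nonempty (Q ≃ₗ[O] (Fin k → ResidueField O)) ∨
      k = 2 ∧ Nonempty (Q ≃ₗ[O] (O ⧸ maximalIdeal O ^ 2)) := by
  have hq : 1 < Nat.card (ResidueField O) := Finite.one_lt_card
  have : Finite Q := (Nat.card_ne_zero.1 (by rw [hQ]; positivity)).2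
  by_cases h : ∃ x : Q, π • x ≠ 0
  · obtain ⟨x, hx⟩ := h
    obtain ⟨h1, h2⟩ := card_sq_le_and_equiv_of_smul_ne_zero hπ hx
    rw [hQ, Nat.pow_le_pow_iff_right hq] at h1
    obtain rfl : k = 2 := le_antisymm hk h1
    exact Or.inr ⟨rfl, h2 hQ⟩
  · push Not at h
    obtain ⟨j, ⟨e⟩⟩ := exists_linearEquiv_residueField_pi (O := O) (Q := Q) (by
      intro a ha x
      rw [hπ, Ideal.mem_span_singleton'] at ha
      obtain ⟨b, rfl⟩ := ha
      rw [mul_smul, h, smul_zero])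
    have hj : j = k := by
      rw [Nat.card_congr e.toEquiv, card_residueField_pi] at hQ
      exact Nat.pow_right_injective hq hQ
    subst hj
    exact Or.inl ⟨e⟩

theorem subalgebraCount_pow_add {π : O} (hπ : maximalIdeal O = Ideal.span {π}) (n : ℕ) {k : ℕ}
    (hk : k ≤ 1) :
    subalgebraCount π n (Nat.card (ResidueField O) ^ (n + k)) =
      {M : Submodule O (Fin n → O) |
        Nonempty (((Fin n → O) ⧸ M) ≃ₗ[O] (Fin k → ResidueField O))}.ncard := by
  rw [subalgebraCount_eq hπ]
  congr 1
  ext M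
  constructor
  · rintro ⟨hM, -⟩
    exact (nonempty_equiv_pi_or_quotient_sq hπ (by omega) hM).resolve_right (by omega)
  · rintro ⟨e⟩
    exact ⟨by rw [Nat.card_congr e.toEquiv, card_residueField_pi],
      fun _ _ _ _ => smul_mem_of_quotient_equiv_pi hπ e _⟩

theorem subalgebraCount_pow_add_two {π : O} (hπ : maximalIdeal O = Ideal.span {π}) (n : ℕ) :
    subalgebraCount π n (Nat.card (ResidueField O) ^ (n + 2)) =
      {M : Submodule O (Fin n → O) |
        Nonempty (((Fin n → O) ⧸ M) ≃ₗ[O] (O ⧸ maximalIdeal O ^ 2)) ∧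
          ∀ x ∈ M, ∀ y ∈ M, π • (x * y) ∈ M}.ncard +
      {M : Submodule O (Fin n → O) |
        Nonempty (((Fin n → O) ⧸ M) ≃ₗ[O] (Fin 2 → ResidueField O))}.ncard := by
  rw [subalgebraCount_eq hπ, ← Set.ncard_union_eq ?_
    (finite_setOf_quotient_equiv.subset fun M hM => hM.1) finite_setOf_quotient_equiv]
  · congr 1
    ext M
    constructor
    · rintro ⟨hM, hmul⟩
      rcases nonempty_equiv_pi_or_quotient_sq hπ le_rfl hM with h | h
      · exact Or.inr h
      · exact Or.inl ⟨h.2, hmul⟩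
    · rintro (⟨⟨e⟩, hmul⟩ | ⟨⟨e⟩⟩)
      · exact ⟨by rw [Nat.card_congr e.toEquiv, card_quotient_maximalIdeal_sq], hmul⟩
      · exact ⟨by rw [Nat.card_congr e.toEquiv, card_residueField_pi],
          fun _ _ _ _ => smul_mem_of_quotient_equiv_pi hπ e _⟩
  -- A quotient `F²` is killed by `π`, whereas `π • 1 ≠ 0` in `O / m²`.
  · rw [Set.disjoint_left]
    rintro M ⟨⟨e⟩, -⟩ ⟨e'⟩
    obtain ⟨x, hx⟩ := (e.surjective.comp M.mkQ_surjective) 1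
    have h1 : M.mkQ (π • x) = 0 :=
      (Submodule.Quotient.mk_eq_zero M).2 (smul_mem_of_quotient_equiv_pi hπ e' x)
    have h2 : π • (1 : O ⧸ maximalIdeal O ^ 2) = 0 := by
      rw [← hx, Function.comp_apply, ← map_smul, ← map_smul, h1, map_zero]
    rw [smul_eq_zero_iff_quotientSqToResidueField_eq_zero hπ] at h2
    exact (isUnit_iff_quotientSqToResidueField_ne_zero _).1 isUnit_one h2

theorem subalgebraCount_pow_self {π : O} (hπ : maximalIdeal O = Ideal.span {π}) (n : ℕ) :
    subalgebraCount π n (Nat.card (ResidueField O) ^ n) = 1 := by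
  have h := ncard_quotient_equiv_pi (R := O) (F := ResidueField O) residue_surjective n 0
  rw [← subalgebraCount_pow_add hπ n zero_le_one] at h
  simpa using h

theorem subalgebraCount_pow_add_one {π : O} (hπ : maximalIdeal O = Ideal.span {π}) (n : ℕ) :
    (subalgebraCount π n (Nat.card (ResidueField O) ^ (n + 1)) : ℚ) =
      gaussianBinomial n 1 (Nat.card (ResidueField O)) := by
  have h := ncard_quotient_equiv_pi (R := O) (F := ResidueField O) residue_surjective n 1
  rw [← subalgebraCount_pow_add hπ n le_rfl] at h
  have hq : 1 < Nat.card (ResidueField O) := Finite.one_lt_card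
  generalize subalgebraCount π n _ = N at h ⊢
  generalize Nat.card (ResidueField O) = q at h hq ⊢
  simp only [Finset.prod_range_one, pow_one, pow_zero] at h
  have h' : (N : ℚ) * (q - 1) = q ^ n - 1 := by
    have := congrArg (Nat.cast : ℕ → ℚ) h
    rwa [Nat.cast_mul, Nat.cast_sub hq.le, Nat.cast_sub (Nat.one_le_pow _ _ (by omega)),
      Nat.cast_pow, Nat.cast_one] at this
  have hq' : (1 : ℚ) < q := by exact_mod_cast hq
  simp only [gaussianBinomial, Finset.prod_range_one, Nat.sub_zero, pow_one]
  rw [eq_div_iff (by linarith)]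
  linear_combination -h'

theorem ncard_quotient_equiv_pi_two {n : ℕ} (hn : 1 ≤ n) :
    ({M : Submodule O (Fin n → O) |
        Nonempty (((Fin n → O) ⧸ M) ≃ₗ[O] (Fin 2 → ResidueField O))}.ncard : ℚ) =
      gaussianBinomial n 2 (Nat.card (ResidueField O)) := by
  have h := ncard_quotient_equiv_pi (R := O) (F := ResidueField O) residue_surjective n 2
  have hq : 1 < Nat.card (ResidueField O) := Finite.one_lt_card
  generalize Set.ncard _ = N at h ⊢
  generalize Nat.card (ResidueField O) = q at h hq ⊢
  have hq' : (1 : ℚ) < q := by exact_mod_cast hq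
  have h' : (N : ℚ) * ((q ^ 2 - 1) * (q ^ 2 - q)) = (q ^ n - 1) * (q ^ n - q) := by
    have := congrArg (Nat.cast : ℕ → ℚ) h
    simp only [Finset.prod_range_succ, Finset.prod_range_zero, one_mul, pow_zero, pow_one] at this
    rwa [Nat.cast_mul, Nat.cast_mul, Nat.cast_mul, Nat.cast_sub (Nat.one_le_pow _ _ (by omega)),
      Nat.cast_sub (Nat.one_le_pow _ _ (by omega)), Nat.cast_sub (Nat.le_self_pow (by omega) q),
      Nat.cast_sub (Nat.le_self_pow (by omega) q), Nat.cast_pow, Nat.cast_pow,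
      Nat.cast_one] at this
  obtain ⟨k, rfl⟩ := Nat.exists_eq_add_of_le' hn
  simp only [gaussianBinomial, Finset.prod_range_succ, Finset.prod_range_zero, one_mul,
    Nat.sub_zero, Nat.add_one_sub_one, pow_one]
  have h1 : (1 : ℚ) - q ≠ 0 := by linarith
  have h2 : (1 : ℚ) - q ^ 2 ≠ 0 := by nlinarith
  have hq0 : (q : ℚ) ≠ 0 := by linarith
  rw [div_mul_div_comm, eq_div_iff (mul_ne_zero h2 h1)]
  -- The count from bases has the factors `q² - q` and `qⁿ - q`, each `q` times a factor of the
  -- Gaussian binomial up to sign; the extra `q` matches them.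
  refine mul_right_cancel₀ hq0 ?_
  rw [pow_succ] at h' ⊢
  linear_combination h'

theorem subalgebraCount_pow_add_two_eq {π : O} (hπ : maximalIdeal O = Ideal.span {π}) {n : ℕ}
    (hn : 1 ≤ n) :
    (subalgebraCount π n (Nat.card (ResidueField O) ^ (n + 2)) : ℚ) =
      ((n + 1).choose 2 : ℚ) * (Nat.card (ResidueField O) : ℚ) ^ (n - 1) +
        gaussianBinomial n 2 (Nat.card (ResidueField O)) := by
  rw [subalgebraCount_pow_add_two hπ, ncard_quotient_equiv_quotient_sq hπ hn, Nat.cast_add,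
    ncard_quotient_equiv_pi_two hn, Nat.cast_mul, Nat.cast_pow]

end DVR

/-- The maximal ideal is open, and an open subgroup of a compact group has finite index. -/
theorem finite_residueField_of_isAdic {O : Type*} [CommRing O] [IsLocalRing O]
    [TopologicalSpace O] [CompactSpace O] (h : IsAdic (maximalIdeal O)) :
    Finite (ResidueField O) := by
  have : IsTopologicalRing O := by
    rw [IsAdic] at h
    subst h
    infer_instance
  have hopen : IsOpen (maximalIdeal O : Set O) := by
    simpa using (isAdic_iff.1 h).1 1
  exact AddSubgroup.quotient_finite_of_isOpen (maximalIdeal O).toAddSubgroup hopen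

/-! ### Irreducible subrings of `ℤ_p^(n+1)` -/

section Padic

variable {p : ℕ} [Fact p.Prime]

/-- The linear map `x ↦ (x_{i+1} - x_0)_i`. -/
def diffMap (R : Type*) [CommRing R] (n : ℕ) : (Fin (n + 1) → R) →ₗ[R] (Fin n → R) where
  toFun x i := x i.succ - x 0
  map_add' x y := by ext i; simp only [Pi.add_apply]; ring
  map_smul' c x := by ext i; simp only [Pi.smul_apply, smul_eq_mul, RingHom.id_apply]; ring

theorem diffMap_surjective (R : Type*) [CommRing R] (n : ℕ) :
    Function.Surjective (diffMap R n) := fun u =>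
  ⟨Fin.cons 0 u, by ext i; simp [diffMap]⟩

/-- The unital subring `{x | (x_{i+1} - x_0)_i ∈ L}`. -/
def diffSubring {R : Type*} [CommRing R] {n : ℕ} (L : NonUnitalSubalgebra R (Fin n → R)) :
    NonUnitalSubring (Fin (n + 1) → R) :=
  { L.toSubmodule.toAddSubgroup.comap (diffMap R n).toAddMonoidHom with
    mul_mem' := by
      intro x y hx hy
      change diffMap R n x ∈ L at hx
      change diffMap R n y ∈ L at hy
      change diffMap R n (x * y) ∈ L
      have h : diffMap R n (x * y) = x 0 • diffMap R n y + y 0 • diffMap R n x +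
          diffMap R n x * diffMap R n y := by
        ext i
        simp only [diffMap, LinearMap.coe_mk, AddHom.coe_mk, Pi.mul_apply, Pi.add_apply,
          Pi.smul_apply, smul_eq_mul]
        ring
      rw [h]
      exact add_mem (add_mem (L.toSubmodule.smul_mem _ hy) (L.toSubmodule.smul_mem _ hx)) (mul_mem hx hy) }

theorem mem_diffSubring {R : Type*} [CommRing R] {n : ℕ} {L : NonUnitalSubalgebra R (Fin n → R)}
    {x : Fin (n + 1) → R} : x ∈ diffSubring L ↔ diffMap R n x ∈ L := Iff.rfl

theorem PadicInt.smul_mem_of_index_eq_pow {V : Type*} [AddCommGroup V] [Module ℤ_[p] V]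
    {H : AddSubgroup V} {e : ℕ} (hH : H.index = p ^ e) (a : ℤ_[p]) {v : V} (hv : v ∈ H) :
    a • v ∈ H := by
  obtain ⟨b, hb⟩ := Ideal.mem_span_singleton'.1 (PadicInt.appr_spec e a)
  have h1 : a = (a.appr e : ℤ_[p]) + (p : ℤ_[p]) ^ e * b := by rw [mul_comm, hb]; ring
  rw [h1, add_smul, mul_smul, ← Nat.cast_pow, Nat.cast_smul_eq_nsmul, Nat.cast_smul_eq_nsmul,
    ← hH]
  exact add_mem (nsmul_mem hv _) (H.nsmul_index_mem _)

theorem irreducibleSubringCount_eq (n e : ℕ) :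
    irreducibleSubringCount p (n + 1) e = subalgebraCount (p : ℤ_[p]) n (p ^ e) := by
  symm
  refine Set.ncard_congr (fun L _ => diffSubring L) ?_ ?_ ?_
  · rintro L ⟨hi, hL⟩
    refine ⟨fun x hx => ?_, ?_, ?_⟩
    · have h0 (i : Fin (n + 1)) : (p : ℤ_[p]) ∣ x i - x 0 := by
        obtain ⟨y, hy⟩ := hL (mem_diffSubring.1 hx)
        refine Fin.cases (by simp) (fun i => ?_) i
        exact ⟨y i, (congrFun hy i).symm⟩
      intro i j
      simpa using dvd_sub (h0 i) (h0 j)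
    · rw [mem_diffSubring]
      have : diffMap ℤ_[p] n 1 = 0 := by ext i; simp [diffMap]
      rw [this]
      exact L.zero_mem
    · rw [← hi]
      exact AddSubgroup.index_comap_of_surjective _ (diffMap_surjective ℤ_[p] n)
  · intro L L' _ _ h
    ext u
    obtain ⟨x, rfl⟩ := diffMap_surjective ℤ_[p] n u
    rw [← mem_diffSubring, ← mem_diffSubring, h]
  · rintro S ⟨hirr, h1, hidx⟩
    have hsmul (a : ℤ_[p]) {v : Fin (n + 1) → ℤ_[p]} (hv : v ∈ S) : a • v ∈ S :=
      PadicInt.smul_mem_of_index_eq_pow hidx a hv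
    let L : NonUnitalSubalgebra ℤ_[p] (Fin n → ℤ_[p]) :=
      { carrier := {u | (Fin.cons 0 u : Fin (n + 1) → ℤ_[p]) ∈ S}
        zero_mem' := by
          convert S.zero_mem using 1
          refine iff_of_eq (congrArg (· ∈ S) ?_)
          ext i; refine Fin.cases ?_ (fun i => ?_) i <;> simp
        add_mem' := by
          intro u v hu hv
          convert S.add_mem hu hv using 1
          refine iff_of_eq (congrArg (· ∈ S) ?_)
          ext i; refine Fin.cases ?_ (fun i => ?_) i <;> simp
        mul_mem' := by
          intro u v hu hv
          convert S.mul_mem hu hv using 1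
          refine iff_of_eq (congrArg (· ∈ S) ?_)
          ext i; refine Fin.cases ?_ (fun i => ?_) i <;> simp
        smul_mem' := by
          intro c u hu
          convert hsmul c hu using 1
          refine iff_of_eq (congrArg (· ∈ S) ?_)
          ext i; refine Fin.cases ?_ (fun i => ?_) i <;> simp }
    have hmem (u : Fin n → ℤ_[p]) : u ∈ L ↔ (Fin.cons 0 u : Fin (n + 1) → ℤ_[p]) ∈ S := Iff.rfl
    have hS : diffSubring L = S := by
      ext x
      have hx : (Fin.cons 0 (diffMap ℤ_[p] n x) : Fin (n + 1) → ℤ_[p]) = x - x 0 • 1 := by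
        ext i; refine Fin.cases ?_ (fun i => ?_) i <;> simp [diffMap]
      rw [mem_diffSubring, hmem, hx]
      exact ⟨fun h => by simpa using S.add_mem h (hsmul (x 0) h1), fun h => S.sub_mem h (hsmul _ h1)⟩
    refine ⟨L, ⟨?_, fun u hu => ?_⟩, hS⟩
    · rw [← hidx, ← hS]
      exact (AddSubgroup.index_comap_of_surjective _ (diffMap_surjective ℤ_[p] n)).symm
    · have h (i : Fin n) : (p : ℤ_[p]) ∣ u i := by simpa using hirr _ hu i.succ 0
      choose y hy using h
      exact ⟨y, funext fun i => (hy i).symm⟩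

theorem PadicInt.card_residueField : Nat.card (ResidueField ℤ_[p]) = p := by
  rw [Nat.card_congr PadicInt.residueField.toEquiv, Nat.card_zmod]

end Padic

theorem mainTheorem5 (n : ℕ) (hn : 1 ≤ n) :
    (∀ (O : Type*) [CommRing O] [IsDomain O] [IsDiscreteValuationRing O]
        [TopologicalSpace O] [CompactSpace O] (_ : IsAdic (IsLocalRing.maximalIdeal O))
        (π : O) (_ : IsLocalRing.maximalIdeal O = Ideal.span {π})
        (q : ℕ) (_ : q = Nat.card (O ⧸ IsLocalRing.maximalIdeal O)),
      (∀ L : NonUnitalSubalgebra O (Fin n → O), subalgebraIndex L ≠ 0 →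
        (L : Set (Fin n → O)) ⊆ uniformizerMultiples π n →
          ∃ m : ℕ, n ≤ m ∧ subalgebraIndex L = q ^ m) ∧
      subalgebraCount π n (q ^ n) = 1 ∧
      (subalgebraCount π n (q ^ (n + 1)) : ℚ) = gaussianBinomial n 1 q ∧
      (subalgebraCount π n (q ^ (n + 2)) : ℚ) =
        ((n + 1).choose 2 : ℚ) * (q : ℚ) ^ (n - 1) + gaussianBinomial n 2 q) ∧
    (∀ (p : ℕ) [Fact p.Prime],
      irreducibleSubringCount p (n + 1) n = 1 ∧
      (irreducibleSubringCount p (n + 1) (n + 1) : ℚ) = (1 - (p : ℚ) ^ n) / (1 - (p : ℚ)) ∧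
      (irreducibleSubringCount p (n + 1) (n + 2) : ℚ) =
        ((n + 1).choose 2 : ℚ) * (p : ℚ) ^ (n - 1) + gaussianBinomial n 2 p) := by
  constructor
  · intro O _ _ _ _ _ hadic π hπ q hq
    have : Finite (ResidueField O) := finite_residueField_of_isAdic hadic
    change q = Nat.card (ResidueField O) at hq
    subst hq
    exact ⟨fun L h0 hL => exists_subalgebraIndex_eq_pow hπ h0 hL, subalgebraCount_pow_self hπ n,
      subalgebraCount_pow_add_one hπ n, subalgebraCount_pow_add_two_eq hπ hn⟩
  · intro p _
    have hπ : maximalIdeal ℤ_[p] = Ideal.span {(p : ℤ_[p])} := PadicInt.maximalIdeal_eq_span_p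
    have hcard := PadicInt.card_residueField (p := p)
    have : Finite (ResidueField ℤ_[p]) := Finite.of_equiv _ PadicInt.residueField.symm.toEquiv
    have h0 := subalgebraCount_pow_self hπ n
    have h1 := subalgebraCount_pow_add_one hπ n
    have h2 := subalgebraCount_pow_add_two_eq hπ hn
    rw [hcard] at h0 h1 h2
    simp only [irreducibleSubringCount_eq]
    refine ⟨h0, ?_, h2⟩
    rw [h1]
    simp [gaussianBinomial]
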